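/- All identities are identities of formal power series in $q$ with integer coefficients. Write $(a;q)_n=\prod_{k=0}^{n-1}(1-aq^k)$ and $(a;q)_\infty=\lim_{n\to\infty}(a;q)_n$. The rank of a partition is its largest part minus its number of parts, the empty partition of $0$ having rank $0$. Let $N_e(n)$ be the number of partitions of $n$ with even rank; in particular $N_e(0)=1$. Then $$\sum_{n=0}^\infty N_e(n)q^n=\frac{1}{(q;q)_\infty}-2\sum_{n=1}^\infty\frac{q^{2n}}{(1-q^{2n})\,(-q^{n+1};q)_n\,(q^{n+1};q)_\infty}.$$ Let Fine's numbers $J(n)$, $n\ge 0$, be defined by $$\sum_{n=0}^\infty J(n)q^n=\sum_{n=1}^\infty\frac{(-1)^nq^{n(3n+1)/2}}{1+q^n}$$ (so that $J(0)=0$). Then $$\sum_{n=0}^\infty J(n)q^n=-\sum_{n=1}^\infty\frac{(q;q)_n\,q^{2n}}{(1-q^{2n})\,(-q^{n+1};q)_n}.$$ All the infinite sums converge coefficientwise. -/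

import Mathlib

open PowerSeries
open scoped PowerSeries.WithPiTopology

/- All series are formal power series in the variable `q = X` with integer coefficients. Infinite
sums and products are taken in the topology of coefficientwise convergence, `ℤ` being discrete. -/

/-- The reciprocal `1 / f` of a formal power series `f` with constant term `1`
(see `mul_recip`). It is only used for such `f`. -/
noncomputable def recip (f : ℤ⟦X⟧) : ℤ⟦X⟧ := PowerSeries.invOfUnit f 1

theorem mul_recip {f : ℤ⟦X⟧} (hf : PowerSeries.constantCoeff f = 1) : f * recip f = 1 :=
  PowerSeries.mul_invOfUnit f 1 (by simpa using hf)

/-- The finite `q`-shifted factorial `(a; q)_n = (1 - a) (1 - a q) ⋯ (1 - a q ^ (n - 1))`, where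
`q = X` and `a` is a power series in `q`. -/
noncomputable def qPoch (a : ℤ⟦X⟧) (n : ℕ) : ℤ⟦X⟧ :=
  ∏ k ∈ Finset.range n, (1 - a * PowerSeries.X ^ k)

/-- The infinite `q`-shifted factorial `(a; q)_∞`, the limit of `(a; q)_n` for `n → ∞`
(see `tendsto_qPoch`). -/
noncomputable def qPochInf (a : ℤ⟦X⟧) : ℤ⟦X⟧ :=
  ∏' k : ℕ, (1 - a * PowerSeries.X ^ k)

/-- The infinite product defining `(a; q)_∞` converges for every `a`. -/
theorem multipliable_qPoch (a : ℤ⟦X⟧) :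
    Multipliable fun k : ℕ ↦ (1 - a * PowerSeries.X ^ k : ℤ⟦X⟧) := by
  simp_rw [sub_eq_add_neg]
  apply PowerSeries.WithPiTopology.multipliable_one_add_of_tendsto_order_atTop_nhds_top
  refine ENat.tendsto_nhds_top_iff_natCast_lt.mpr
    (fun n ↦ Filter.eventually_atTop.mpr ⟨n + 1, fun m hm ↦ ?_⟩)
  rw [PowerSeries.order_neg]
  refine lt_of_lt_of_le ?_ (PowerSeries.le_order_mul _ _)
  rw [PowerSeries.order_X_pow]
  exact lt_of_lt_of_le (by exact_mod_cast hm) le_add_self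

theorem tendsto_qPoch (a : ℤ⟦X⟧) :
    Filter.Tendsto (qPoch a) Filter.atTop (nhds (qPochInf a)) :=
  (multipliable_qPoch a).hasProd.tendsto_prod_nat

/-- The rank of a partition: its largest part minus its number of parts. The empty partition
(of `0`) has rank `0`. -/
def partitionRank {n : ℕ} (p : n.Partition) : ℤ :=
  (p.parts.sup : ℤ) - (p.parts.card : ℤ)

/-- `N_e(n)`, the number of partitions of `n` with even rank. -/
def evenRankCount (n : ℕ) : ℕ :=
  Fintype.card {p : n.Partition // Even (partitionRank p)}

/-- The `n`-th term `(-1) ^ n * q ^ (n (3 n + 1) / 2) / (1 + q ^ n)` of Fine's series; the product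
`n * (3 * n + 1)` is always even. Only the terms with `1 ≤ n` are used. -/
noncomputable def fineTerm (n : ℕ) : ℤ⟦X⟧ :=
  (-1) ^ n * PowerSeries.X ^ (n * (3 * n + 1) / 2) * recip (1 + PowerSeries.X ^ n)

/-- Fine's series, the sum over `1 ≤ n`, converges. -/
theorem summable_fineTerm : Summable fun n : ℕ ↦ fineTerm (n + 1) := by
  apply PowerSeries.WithPiTopology.summable_of_tendsto_order_atTop_nhds_top
  refine ENat.tendsto_nhds_top_iff_natCast_lt.mpr
    (fun n ↦ Filter.eventually_atTop.mpr ⟨n, fun m hm ↦ ?_⟩)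
  have h : n < (m + 1) * (3 * (m + 1) + 1) / 2 := by
    have : m * 2 + 2 ≤ (m + 1) * (3 * (m + 1) + 1) := by nlinarith
    omega
  refine lt_of_lt_of_le (b := (((m + 1) * (3 * (m + 1) + 1) / 2 : ℕ) : ℕ∞))
    (by exact_mod_cast h) (PowerSeries.nat_le_order _ _ fun i hi ↦ ?_)
  rw [fineTerm, mul_comm ((-1 : ℤ⟦X⟧) ^ (m + 1)), mul_assoc, PowerSeries.coeff_X_pow_mul',
    if_neg (by omega)]

/-- Fine's numbers `J(n)`, the coefficients of Fine's series:
`∑ J(n) q ^ n = ∑_{n ≥ 1} (-1) ^ n q ^ (n (3 n + 1) / 2) / (1 + q ^ n)`. (So `J(0) = 0`.) -/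
noncomputable def fineJ (n : ℕ) : ℤ :=
  PowerSeries.coeff n (∑' k : ℕ, fineTerm (k + 1))

/-- The term `q ^ (2 n) / ((1 - q ^ (2 n)) (-q ^ (n + 1); q)_n (q ^ (n + 1); q)_∞)`, for `1 ≤ n`. -/
noncomputable def evenRankTerm (n : ℕ) : ℤ⟦X⟧ :=
  PowerSeries.X ^ (2 * n) *
    recip ((1 - PowerSeries.X ^ (2 * n)) * qPoch (-PowerSeries.X ^ (n + 1)) n *
      qPochInf (PowerSeries.X ^ (n + 1)))

/-- The term `(q; q)_n q ^ (2 n) / ((1 - q ^ (2 n)) (-q ^ (n + 1); q)_n)`, for `1 ≤ n`. -/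
noncomputable def fineSumTerm (n : ℕ) : ℤ⟦X⟧ :=
  qPoch PowerSeries.X n * PowerSeries.X ^ (2 * n) *
    recip ((1 - PowerSeries.X ^ (2 * n)) * qPoch (-PowerSeries.X ^ (n + 1)) n)

/-! ### Divisibility by powers of `X` and convergence -/

/-! Write `F` for Fine's series and `P = 1/(q;q)_∞`. Since `(q;q)_∞ = (q;q)_n (q^(n+1);q)_∞`, each
term of the first sum is `P` times the corresponding term of the second (`evenRankTerm_succ`). Two
facts therefore suffice: the even-rank series equals `P (1 + 2F)`, and `F` is minus the second sum.

The first fact is combinatorial. Removing the first row and first column of a nonempty Ferrers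
diagram leaves a partition in a box, counted by a Gaussian binomial. Conjugation negates the rank,
so the odd-rank partitions are twice those of positive odd rank (`mk_evenRankCount`). The q-Pascal
rules give recurrences for the rank tails, whose unique solution is `P` times a partial theta series
(`rankTail_eq`). Telescoping in steps of two turns these into Lerch-type sums
(`rankTailStepTwo_eq`), and the one for odd positive ranks is `-F` (`rankLerch_one`).

The second fact is Bailey's transform in base `Q = q^2`. The terms of the sum are `q^(2n)
(Q;Q)_(n-1) (Q;Q)_n β_n` with `β_n = 1/((-q;q)_(2n) (Q;Q)_n)` (`fineSumTerm_succ`), and `β_n`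
belongs to a Bailey pair with pentagonal exponents (`qPoch_neg_mul_alphaSum`). After passing to the
kernel relative to `Q` (`sum_baileyOdd_eq`), the sum over `n` telescopes in closed form
(`conjSum_succ_right`, `one_sub_mul_conjSum_zero`), and partial fractions in what remains give `-F`
(`sum_fineTerm`).

Limits are handled as congruences modulo powers of `X`. -/

theorem coeff_eq_of_X_pow_dvd_sub {f g : ℤ⟦X⟧} {n d : ℕ} (h : (X : ℤ⟦X⟧) ^ n ∣ f - g)
    (hd : d < n) : coeff d f = coeff d g := by
  have := X_pow_dvd_iff.mp h d hd
  rwa [map_sub, sub_eq_zero] at this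

theorem eq_of_forall_X_pow_dvd_sub {f g : ℤ⟦X⟧} (h : ∀ n : ℕ, (X : ℤ⟦X⟧) ^ n ∣ f - g) :
    f = g := by
  ext d
  exact coeff_eq_of_X_pow_dvd_sub (h (d + 1)) d.lt_succ_self

theorem hasSum_of_X_pow_dvd {f : ℕ → ℤ⟦X⟧} {a : ℤ⟦X⟧} (hf : ∀ n, (X : ℤ⟦X⟧) ^ n ∣ f n)
    (ha : ∀ n, (X : ℤ⟦X⟧) ^ n ∣ a - ∑ i ∈ Finset.range n, f i) : HasSum f a := by
  rw [WithPiTopology.hasSum_iff_hasSum_coeff]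
  intro d
  rw [coeff_eq_of_X_pow_dvd_sub (ha (d + 1)) d.lt_succ_self, map_sum]
  refine hasSum_sum_of_ne_finset_zero fun i hi ↦ ?_
  exact X_pow_dvd_iff.mp (hf i) d (by simpa using hi)

theorem summable_of_X_pow_dvd {f : ℕ → ℤ⟦X⟧} (hf : ∀ n, (X : ℤ⟦X⟧) ^ n ∣ f n) : Summable f := by
  refine ⟨PowerSeries.mk fun d ↦ coeff d (∑ i ∈ Finset.range (d + 1), f i),
    hasSum_of_X_pow_dvd hf fun n ↦ X_pow_dvd_iff.mpr fun d hd ↦ ?_⟩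
  rw [map_sub, coeff_mk, sub_eq_zero, map_sum, map_sum]
  refine Finset.sum_subset (Finset.range_mono hd) fun i _ hi ↦ ?_
  exact X_pow_dvd_iff.mp (hf i) d (by simpa using hi)

theorem X_pow_dvd_tsum {f : ℕ → ℤ⟦X⟧} {k : ℕ} (hs : Summable f) (hf : ∀ n, (X : ℤ⟦X⟧) ^ k ∣ f n) :
    (X : ℤ⟦X⟧) ^ k ∣ ∑' n, f n := by
  refine X_pow_dvd_iff.mpr fun d hd ↦ ?_
  rw [hs.map_tsum _ (WithPiTopology.continuous_coeff ℤ d)]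
  simp [fun n ↦ X_pow_dvd_iff.mp (hf n) d hd]

theorem X_pow_dvd_sub_of_tendsto {f : ℕ → ℤ⟦X⟧} {a b : ℤ⟦X⟧} {k : ℕ}
    (h : Filter.Tendsto f Filter.atTop (nhds a)) (hf : ∀ n, (X : ℤ⟦X⟧) ^ k ∣ f n - b) :
    (X : ℤ⟦X⟧) ^ k ∣ a - b := by
  refine X_pow_dvd_iff.mpr fun d hd ↦ ?_
  rw [map_sub, sub_eq_zero]
  refine tendsto_nhds_unique ((WithPiTopology.tendsto_iff_coeff_tendsto ℤ _ _ _).mp h d) ?_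
  simp [fun n ↦ coeff_eq_of_X_pow_dvd_sub (hf n) hd]

/-! ### Reciprocals and `q`-shifted factorials -/

theorem ne_zero_of_constantCoeff {f : ℤ⟦X⟧} (hf : constantCoeff f = 1) : f ≠ 0 := by
  rintro rfl
  simp at hf

theorem eq_recip {f g : ℤ⟦X⟧} (hf : constantCoeff f = 1) (h : f * g = 1) : g = recip f :=
  mul_left_cancel₀ (ne_zero_of_constantCoeff hf) (h.trans (mul_recip hf).symm)

theorem recip_one : recip 1 = 1 := (eq_recip (by simp) (by simp)).symm

theorem recip_mul {f g : ℤ⟦X⟧} (hf : constantCoeff f = 1) (hg : constantCoeff g = 1) :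
    recip (f * g) = recip f * recip g := by
  refine (eq_recip (by simp [hf, hg]) ?_).symm
  linear_combination (g * recip g) * mul_recip hf + mul_recip hg

theorem X_pow_dvd_recip_sub {f g : ℤ⟦X⟧} {n : ℕ} (hf : constantCoeff f = 1)
    (hg : constantCoeff g = 1) (h : (X : ℤ⟦X⟧) ^ n ∣ f - g) :
    (X : ℤ⟦X⟧) ^ n ∣ recip f - recip g := by
  have : recip f - recip g = (f - g) * (- recip f * recip g) := by
    linear_combination (-recip f) * mul_recip hg + (recip g) * mul_recip hf
  exact this ▸ h.mul_right _

theorem constantCoeff_qPoch {a : ℤ⟦X⟧} (ha : constantCoeff a = 0) (n : ℕ) :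
    constantCoeff (qPoch a n) = 1 := by
  simp [qPoch, map_prod, ha]

theorem qPoch_zero (a : ℤ⟦X⟧) : qPoch a 0 = 1 := by simp [qPoch]

theorem qPoch_succ (a : ℤ⟦X⟧) (n : ℕ) : qPoch a (n + 1) = qPoch a n * (1 - a * X ^ n) := by
  simp [qPoch, Finset.prod_range_succ]

theorem qPoch_add (a : ℤ⟦X⟧) (m n : ℕ) : qPoch a (m + n) = qPoch a m * qPoch (a * X ^ m) n := by
  simp only [qPoch, Finset.prod_range_add]
  congr 1
  exact Finset.prod_congr rfl fun k _ ↦ by ring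

theorem X_pow_dvd_qPoch_sub_one {a : ℤ⟦X⟧} {k : ℕ} (ha : (X : ℤ⟦X⟧) ^ k ∣ a) (n : ℕ) :
    (X : ℤ⟦X⟧) ^ k ∣ qPoch a n - 1 := by
  induction n with
  | zero => simp [qPoch_zero]
  | succ n ih =>
    rw [qPoch_succ, show qPoch a n * (1 - a * X ^ n) - 1 = (qPoch a n - 1)
      + a * -(qPoch a n * X ^ n) by ring]
    exact dvd_add ih (ha.mul_right _)

theorem X_pow_dvd_qPochInf_sub_one {a : ℤ⟦X⟧} {k : ℕ} (ha : (X : ℤ⟦X⟧) ^ k ∣ a) :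
    (X : ℤ⟦X⟧) ^ k ∣ qPochInf a - 1 :=
  X_pow_dvd_sub_of_tendsto (tendsto_qPoch a) (X_pow_dvd_qPoch_sub_one ha)

theorem constantCoeff_qPochInf {a : ℤ⟦X⟧} (ha : constantCoeff a = 0) :
    constantCoeff (qPochInf a) = 1 := by
  have := coeff_eq_of_X_pow_dvd_sub (X_pow_dvd_qPochInf_sub_one (a := a) (k := 1)
    (by simpa [X_dvd_iff] using ha)) Nat.zero_lt_one
  simpa using this

theorem qPochInf_eq_qPoch_mul (a : ℤ⟦X⟧) (n : ℕ) :
    qPochInf a = qPoch a n * qPochInf (a * X ^ n) := by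
  refine tendsto_nhds_unique ((tendsto_qPoch a).comp (Filter.tendsto_add_atTop_nat n)) ?_
  refine ((tendsto_qPoch (a * X ^ n)).const_mul (qPoch a n)).congr fun m ↦ ?_
  rw [Function.comp_apply, add_comm m, qPoch_add]

theorem qPoch_X_succ (n : ℕ) : qPoch X (n + 1) = qPoch X n * (1 - X ^ (n + 1)) := by
  rw [qPoch_succ, pow_succ']

theorem constantCoeff_qPoch_X (n : ℕ) : constantCoeff (qPoch X n) = 1 :=
  constantCoeff_qPoch (by simp) n

theorem X_pow_dvd_qPoch_X_add_sub (n m : ℕ) :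
    (X : ℤ⟦X⟧) ^ (n + 1) ∣ qPoch X (n + m) - qPoch X n := by
  rw [qPoch_add, ← mul_sub_one]
  exact (X_pow_dvd_qPoch_sub_one (pow_succ' X n).dvd m).mul_left _

theorem X_pow_dvd_qPochInf_sub_qPoch (n : ℕ) :
    (X : ℤ⟦X⟧) ^ (n + 1) ∣ qPochInf X - qPoch X n := by
  rw [qPochInf_eq_qPoch_mul X n, ← mul_sub_one]
  exact (X_pow_dvd_qPochInf_sub_one (pow_succ' X n).dvd).mul_left _

/-! ### Gaussian binomial coefficients -/

/-- The Gaussian binomial coefficient `(q; q)_{i + j} / ((q; q)_i (q; q)_j)`. -/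
noncomputable def gaussBinom (i j : ℕ) : ℤ⟦X⟧ :=
  qPoch X (i + j) * recip (qPoch X i * qPoch X j)

theorem constantCoeff_qPoch_X_mul (i j : ℕ) :
    constantCoeff (qPoch X i * qPoch X j) = 1 := by
  simp [constantCoeff_qPoch_X]

theorem gaussBinom_mul (i j : ℕ) :
    gaussBinom i j * (qPoch X i * qPoch X j) = qPoch X (i + j) := by
  rw [gaussBinom]
  linear_combination qPoch X (i + j) * mul_recip (constantCoeff_qPoch_X_mul i j)

theorem gaussBinom_comm (i j : ℕ) : gaussBinom i j = gaussBinom j i := by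
  rw [gaussBinom, gaussBinom, add_comm, mul_comm (qPoch X i)]

theorem gaussBinom_zero_right (i : ℕ) : gaussBinom i 0 = 1 := by
  rw [gaussBinom, qPoch_zero, mul_one, add_zero, mul_recip (constantCoeff_qPoch_X i)]

theorem gaussBinom_zero_left (j : ℕ) : gaussBinom 0 j = 1 := by
  rw [gaussBinom_comm, gaussBinom_zero_right]

theorem gaussBinom_succ_succ (i j : ℕ) :
    gaussBinom (i + 1) (j + 1) = gaussBinom (i + 1) j + X ^ (j + 1) * gaussBinom i (j + 1) := by
  refine mul_right_cancel₀ (ne_zero_of_constantCoeff (constantCoeff_qPoch_X_mul (i + 1) (j + 1))) ?_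
  have h1 := gaussBinom_mul (i + 1) (j + 1)
  have h2 := gaussBinom_mul (i + 1) j
  have h3 := gaussBinom_mul i (j + 1)
  rw [show i + 1 + (j + 1) = i + j + 1 + 1 by ring, qPoch_X_succ (i + j + 1)] at h1
  rw [show i + 1 + j = i + j + 1 by ring] at h2
  rw [show i + (j + 1) = i + j + 1 by ring] at h3
  rw [h1]
  rw [qPoch_X_succ j] at h3 ⊢
  rw [qPoch_X_succ i] at h2 ⊢
  linear_combination (-(1 - X ^ (j + 1))) * h2 - X ^ (j + 1) * (1 - X ^ (i + 1)) * h3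

theorem gaussBinom_succ_succ' (i j : ℕ) :
    gaussBinom (i + 1) (j + 1) = X ^ (i + 1) * gaussBinom (i + 1) j + gaussBinom i (j + 1) := by
  rw [gaussBinom_comm, gaussBinom_succ_succ, gaussBinom_comm j, gaussBinom_comm (j + 1), add_comm]

theorem X_pow_dvd_gaussBinom_sub_recip (l r : ℕ) :
    (X : ℤ⟦X⟧) ^ (l + r + 1) ∣ gaussBinom l (l + r) - recip (qPoch X l) := by
  have h : gaussBinom l (l + r) - recip (qPoch X l)
      = (qPoch X (l + r + l) - qPoch X (l + r)) * recip (qPoch X l * qPoch X (l + r)) := by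
    rw [gaussBinom, recip_mul (constantCoeff_qPoch_X _) (constantCoeff_qPoch_X _), add_comm l]
    linear_combination recip (qPoch X l) * mul_recip (constantCoeff_qPoch_X (l + r))
  exact h ▸ (X_pow_dvd_qPoch_X_add_sub _ _).mul_right _

/-- Telescoping: for `l ≥ 1` the `l`-th term is `1/(q;q)_l - 1/(q;q)_(l-1)`. -/
theorem hasSum_X_pow_mul_recip_qPoch :
    HasSum (fun l : ℕ ↦ X ^ l * recip (qPoch X l)) (recip (qPochInf X)) := by
  have hsum : ∀ n : ℕ, ∑ l ∈ Finset.range (n + 1), X ^ l * recip (qPoch X l)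
      = recip (qPoch X n) := by
    intro n
    induction n with
    | zero => simp
    | succ n ih =>
      rw [Finset.sum_range_succ, ih, qPoch_X_succ, recip_mul (constantCoeff_qPoch_X n) (by simp)]
      linear_combination (-recip (qPoch X n)) * mul_recip (f := 1 - X ^ (n + 1)) (by simp)
  refine hasSum_of_X_pow_dvd (fun n ↦ Dvd.intro _ rfl) fun n ↦ ?_
  cases n with
  | zero => simp
  | succ n =>
    rw [hsum]
    exact X_pow_dvd_recip_sub (constantCoeff_qPochInf (by simp)) (constantCoeff_qPoch_X n)
      (X_pow_dvd_qPochInf_sub_qPoch n)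

/-! ### Ranks and Gaussian binomial coefficients

`gaussBinom i j * X ^ (i + j + 1)` counts the partitions with `i + 1` parts and largest part
`j + 1`. -/

/-- `X ^ (r + 1) * rankTail r` counts the partitions of rank at least `r`. -/
noncomputable def rankTail (r : ℕ) : ℤ⟦X⟧ := ∑' l : ℕ, X ^ l * gaussBinom l (l + r)

/-- The generating function of the nonempty partitions of rank `d`. -/
noncomputable def rankEq (d : ℕ) : ℤ⟦X⟧ := ∑' l : ℕ, X ^ (2 * l + d + 1) * gaussBinom l (l + d)

theorem summable_rankTail (r : ℕ) : Summable fun l : ℕ ↦ X ^ l * gaussBinom l (l + r) :=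
  summable_of_X_pow_dvd fun _ ↦ Dvd.intro _ rfl

theorem summable_X_pow_mul {e : ℕ → ℕ} (he : ∀ n, n ≤ e n) (f : ℕ → ℤ⟦X⟧) :
    Summable fun n ↦ X ^ e n * f n :=
  summable_of_X_pow_dvd fun n ↦ (pow_dvd_pow _ (he n)).mul_right _

/-- The first q-Pascal rule applied termwise. The terms `l = 0` agree, so they are split off and the
rest is shifted. -/
theorem rankTail_succ (r : ℕ) : rankTail (r + 1) = rankTail r + rankEq (r + 2) := by
  rw [rankTail, rankTail, rankEq, (summable_rankTail (r + 1)).tsum_eq_zero_add,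
    (summable_rankTail r).tsum_eq_zero_add, add_assoc, ← Summable.tsum_add]
  · congr 1
    · simp [gaussBinom_zero_left]
    · refine tsum_congr fun l ↦ ?_
      rw [show l + 1 + (r + 1) = l + r + 1 + 1 by ring, gaussBinom_succ_succ,
        show l + 1 + r = l + r + 1 by ring, show l + (r + 2) = l + r + 1 + 1 by ring]
      ring
  · exact summable_X_pow_mul (fun n ↦ n.le_succ) _
  · exact summable_X_pow_mul (fun n ↦ by lia) _

/-- The second q-Pascal rule. Iterating it identifies `X ^ (d + 1) * rankTail (d + 1)` with the
generating function of the nonempty partitions of rank at least `d`. -/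
theorem rankTail_sub (d : ℕ) :
    X ^ (d + 1) * rankTail (d + 1) = X ^ (d + 2) * rankTail (d + 2) + rankEq d := by
  have h : rankTail (d + 1) = X * rankTail (d + 2)
      + ∑' l : ℕ, X ^ (2 * l) * gaussBinom l (l + d) := by
    have hs : Summable fun l : ℕ ↦ X ^ (2 * l) * gaussBinom l (l + d) :=
      summable_X_pow_mul (fun n ↦ by lia) _
    rw [rankTail, rankTail, (summable_rankTail (d + 1)).tsum_eq_zero_add, hs.tsum_eq_zero_add,
      ← Summable.tsum_mul_left, add_left_comm (∑' l : ℕ, X * (X ^ l * gaussBinom l (l + (d + 2)))),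
      ← Summable.tsum_add]
    · congr 1
      · simp [gaussBinom_zero_left]
      · refine tsum_congr fun l ↦ ?_
        rw [show l + 1 + (d + 1) = l + d + 1 + 1 by ring, gaussBinom_succ_succ',
          show l + 1 + d = l + d + 1 by ring, show l + (d + 2) = l + d + 1 + 1 by ring]
        ring
    · exact (summable_rankTail (d + 2)).mul_left _
    · exact summable_X_pow_mul (fun n ↦ by lia) _
    · exact summable_rankTail (d + 2)
  rw [h, rankEq, mul_add, ← Summable.tsum_mul_left]
  · rw [← mul_assoc, ← pow_succ]
    congr 1
    exact tsum_congr fun l ↦ by ring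
  · exact summable_X_pow_mul (fun n ↦ by lia) _

/-- By the two preceding recurrences the left side does not change when `r` grows by one. As `r → ∞`
the second term vanishes and the Gaussian binomials in the first tend to `1/(q;q)_l`. -/
theorem rankTail_add (r : ℕ) :
    rankTail r + X ^ (r + 3) * rankTail (r + 3) = recip (qPochInf X) := by
  have hstep : ∀ m, rankTail r + X ^ (r + 3) * rankTail (r + 3)
      = rankTail (r + m) + X ^ (r + m + 3) * rankTail (r + m + 3) := by
    intro m
    induction m with
    | zero => rfl
    | succ m ih =>
      have h1 := rankTail_succ (r + m)
      have h2 := rankTail_sub (r + m + 2)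
      rw [ih, ← add_assoc, h1]
      linear_combination h2
  refine eq_of_forall_X_pow_dvd_sub fun n ↦ ?_
  rw [hstep n, ← hasSum_X_pow_mul_recip_qPoch.tsum_eq, rankTail, add_sub_right_comm,
    ← Summable.tsum_sub (summable_rankTail _) hasSum_X_pow_mul_recip_qPoch.summable]
  refine dvd_add (X_pow_dvd_tsum ((summable_rankTail _).sub
    hasSum_X_pow_mul_recip_qPoch.summable) fun l ↦ ?_) ?_
  · rw [← mul_sub]
    exact ((pow_dvd_pow _ (by lia)).trans (X_pow_dvd_gaussBinom_sub_recip l (r + n))).mul_left _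
  · exact (pow_dvd_pow _ (by lia)).mul_right _

/-- Multiplied by `1 / (q; q)_∞`, this is `rankTail r`. -/
noncomputable def rankTheta (r : ℕ) : ℤ⟦X⟧ :=
  ∑' k : ℕ, X ^ (k * r + 3 * (k * (k + 1) / 2)) * (-1) ^ k

theorem triangle_succ (k : ℕ) : (k + 1) * (k + 1 + 1) / 2 = k * (k + 1) / 2 + k + 1 := by
  rw [show (k + 1) * (k + 1 + 1) = k * (k + 1) + (k + 1) * 2 by ring,
    Nat.add_mul_div_right _ _ two_pos, add_assoc]

theorem le_triangle (k : ℕ) : k ≤ k * (k + 1) / 2 := by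
  rcases k with _ | k
  · simp
  · rw [triangle_succ]; lia

theorem summable_rankTheta (r : ℕ) :
    Summable fun k : ℕ ↦ (X : ℤ⟦X⟧) ^ (k * r + 3 * (k * (k + 1) / 2)) * (-1) ^ k :=
  summable_X_pow_mul (fun k ↦ by have := le_triangle k; lia) _

theorem rankTheta_add (r : ℕ) : rankTheta r + X ^ (r + 3) * rankTheta (r + 3) = 1 := by
  rw [rankTheta, rankTheta, (summable_rankTheta r).tsum_eq_zero_add,
    ← (summable_rankTheta (r + 3)).tsum_mul_left, add_assoc,
    ← Summable.tsum_add _ ((summable_rankTheta (r + 3)).mul_left _)]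
  · rw [show (fun k : ℕ ↦ (X : ℤ⟦X⟧) ^ ((k + 1) * r + 3 * ((k + 1) * (k + 1 + 1) / 2))
        * (-1) ^ (k + 1) + X ^ (r + 3) * (X ^ (k * (r + 3) + 3 * (k * (k + 1) / 2)) * (-1) ^ k))
        = fun _ ↦ 0 from funext fun k ↦ ?_]
    · simp
    · rw [triangle_succ]
      ring
  · exact (summable_nat_add_iff 1).mpr (summable_rankTheta r)

/-- Each use of the recurrence gains a factor `X`. This makes the solution of an inhomogeneous
recurrence of this shape unique. -/
theorem eq_zero_of_eq_X_pow_mul_add {E : ℕ → ℤ⟦X⟧} {s : ℕ} {e : ℕ → ℕ}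
    (he : ∀ n, 0 < e n) (h : ∀ n, E n = -X ^ (e n) * E (n + s)) (n : ℕ) : E n = 0 := by
  have key : ∀ k n, (X : ℤ⟦X⟧) ^ k ∣ E n := by
    intro k
    induction k with
    | zero => simp
    | succ k ih =>
      intro n
      rw [h n, pow_succ', neg_mul]
      exact (mul_dvd_mul (dvd_pow_self _ (he n).ne') (ih _)).neg_right
  exact eq_of_forall_X_pow_dvd_sub fun k ↦ by simpa using key k n

theorem rankTail_eq (r : ℕ) : rankTail r = recip (qPochInf X) * rankTheta r := by
  refine sub_eq_zero.mp (eq_zero_of_eq_X_pow_mul_add (s := 3) (e := fun n ↦ n + 3)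
    (E := fun r ↦ rankTail r - recip (qPochInf X) * rankTheta r) (fun n ↦ by lia)
    (fun n ↦ ?_) r)
  linear_combination rankTail_add n - recip (qPochInf X) * rankTheta_add n

/-- The sum over `1 ≤ n` of `(-1) ^ (n - 1) q ^ (n (3 n - 1) / 2 + d n) / (1 + q ^ n)`. -/
noncomputable def rankLerch (d : ℕ) : ℤ⟦X⟧ :=
  ∑' k : ℕ, X ^ (k * (d + 1) + d + 1 + 3 * (k * (k + 1) / 2))
    * ((-1) ^ k * recip (1 + X ^ (k + 1)))

theorem summable_rankLerch (d : ℕ) :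
    Summable fun k : ℕ ↦ (X : ℤ⟦X⟧) ^ (k * (d + 1) + d + 1 + 3 * (k * (k + 1) / 2))
    * ((-1) ^ k * recip (1 + X ^ (k + 1))) :=
  summable_X_pow_mul (fun k ↦ by have := le_triangle k; lia) _

/-- Raising `d` by one multiplies the term of index `k` by `X ^ (k + 1)`, so the sum of the two
terms cancels the denominator. -/
theorem rankLerch_add (d : ℕ) :
    rankLerch d + rankLerch (d + 1) = X ^ (d + 1) * rankTheta (d + 1) := by
  rw [rankLerch, rankLerch, rankTheta, ← (summable_rankTheta _).tsum_mul_left,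
    ← (summable_rankLerch _).tsum_add (summable_rankLerch _)]
  refine tsum_congr fun k ↦ ?_
  have := mul_recip (f := 1 + X ^ (k + 1)) (by simp)
  rw [show k * (d + 1 + 1) + (d + 1) + 1 + 3 * (k * (k + 1) / 2)
    = (k * (d + 1) + d + 1 + 3 * (k * (k + 1) / 2)) + (k + 1) by ring]
  linear_combination (X ^ (k * (d + 1) + d + 1 + 3 * (k * (k + 1) / 2)) * (-1) ^ k) * this

theorem rankLerch_one : rankLerch 1 = -∑' k : ℕ, fineTerm (k + 1) := by
  rw [rankLerch, ← tsum_neg]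
  refine tsum_congr fun k ↦ ?_
  rw [fineTerm, show (k + 1) * (3 * (k + 1) + 1) / 2 = k * (1 + 1) + 1 + 1 + 3 * (k * (k + 1) / 2)
    from ?_]
  · ring
  · have := triangle_succ k
    have h2 : 2 ∣ k * (k + 1) := (Nat.even_mul_succ_self k).two_dvd
    obtain ⟨c, hc⟩ := h2
    rw [show (k + 1) * (3 * (k + 1) + 1) = 3 * (k * (k + 1)) + (2 * k + 2) * 2 by ring, hc]
    lia

/-- The generating function of the partitions of rank `d`, `d + 2`, `d + 4`, …. -/
noncomputable def rankTailStepTwo (d : ℕ) : ℤ⟦X⟧ :=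
  ∑' m : ℕ, X ^ (2 * m + d + 1) * ∑ j ∈ Finset.range (m + 1), gaussBinom j (2 * m + d - j)

theorem rankTailStepTwo_eq_add (d : ℕ) :
    rankTailStepTwo d = rankTailStepTwo (d + 2) + rankEq d := by
  have hs : ∀ f : ℕ → ℤ⟦X⟧, Summable fun m ↦ X ^ (2 * m + d + 1) * f m :=
    summable_X_pow_mul fun m ↦ by lia
  have hsplit : rankTailStepTwo d = ∑' m : ℕ, (X ^ (2 * m + d + 1)
      * ∑ j ∈ Finset.range m, gaussBinom j (2 * m + d - j)
      + X ^ (2 * m + d + 1) * gaussBinom m (m + d)) :=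
    tsum_congr fun m ↦ by
      rw [Finset.sum_range_succ, mul_add, show 2 * m + d - m = m + d by lia]
  rw [hsplit, Summable.tsum_add (hs _) (hs _), (hs _).tsum_eq_zero_add, rankEq, rankTailStepTwo]
  simp only [Finset.range_zero, Finset.sum_empty, mul_zero, zero_add]
  congr 1
  refine tsum_congr fun m ↦ ?_
  rw [show 2 * (m + 1) + d = 2 * m + (d + 2) by ring]

/-- Both sides have the same difference between `d` and `d + 2`, namely `rankEq d`, a difference of
consecutive rank tails, and both tend to zero as `d` grows. -/
theorem rankTailStepTwo_eq (d : ℕ) :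
    rankTailStepTwo d = recip (qPochInf X) * rankLerch d := by
  have hstep : ∀ n, rankTailStepTwo n - recip (qPochInf X) * rankLerch n
      = rankTailStepTwo (n + 2) - recip (qPochInf X) * rankLerch (n + 2) := by
    intro n
    have h := rankTail_sub n
    rw [rankTail_eq, rankTail_eq] at h
    linear_combination rankTailStepTwo_eq_add n + recip (qPochInf X) * rankLerch_add (n + 1)
      - recip (qPochInf X) * rankLerch_add n - h
  have hiter : ∀ k, rankTailStepTwo d - recip (qPochInf X) * rankLerch d
      = rankTailStepTwo (d + 2 * k) - recip (qPochInf X) * rankLerch (d + 2 * k) := by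
    intro k
    induction k with
    | zero => rfl
    | succ k ih => rw [ih, hstep]; rfl
  refine eq_of_forall_X_pow_dvd_sub fun k ↦ ?_
  rw [hiter k]
  refine dvd_sub (X_pow_dvd_tsum (summable_X_pow_mul (fun m ↦ by lia) _) fun m ↦ ?_)
    ((X_pow_dvd_tsum (summable_rankLerch _) fun m ↦ ?_).mul_left _)
  · exact (pow_dvd_pow _ (by lia)).mul_right _
  · exact (pow_dvd_pow _ (by lia)).mul_right _

/-! ### The signed generating function of partitions by rank -/

theorem constantCoeff_mul_X (e : ℤ⟦X⟧) : constantCoeff (e * X) = 0 := by simp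

/-- A case of the q-binomial theorem, by induction on `n`: Pascal's rule shows that multiplying the
series for `n + 1` by the new factor gives the series for `n`. -/
theorem recip_qPoch_succ_eq_tsum (e : ℤ⟦X⟧) (n : ℕ) :
    recip (qPoch (e * X) (n + 1)) = ∑' j : ℕ, X ^ j * (e ^ j * gaussBinom n j) := by
  have hs : ∀ n, Summable fun j : ℕ ↦ X ^ j * (e ^ j * gaussBinom n j) := fun n ↦
    summable_X_pow_mul (fun j ↦ le_rfl) _
  refine (eq_recip (constantCoeff_qPoch (constantCoeff_mul_X e) _) ?_).symm
  induction n with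
  | zero =>
    have h : ∑' j : ℕ, X ^ j * (e ^ j * gaussBinom 0 j)
        = 1 + e * X * ∑' j : ℕ, X ^ j * (e ^ j * gaussBinom 0 j) := by
      conv_lhs => rw [(hs 0).tsum_eq_zero_add]
      rw [← (hs 0).tsum_mul_left]
      congr 1
      · simp [gaussBinom_zero_left]
      · exact tsum_congr fun j ↦ by simp only [gaussBinom_zero_left]; ring
    rw [qPoch_succ, qPoch_zero]
    linear_combination h
  | succ n ih =>
    have h : ∑' j : ℕ, X ^ j * (e ^ j * gaussBinom (n + 1) j)
        = ∑' j : ℕ, X ^ j * (e ^ j * gaussBinom n j)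
          + e * X ^ (n + 2) * ∑' j : ℕ, X ^ j * (e ^ j * gaussBinom (n + 1) j) := by
      conv_lhs => rw [(hs (n + 1)).tsum_eq_zero_add]
      rw [(hs n).tsum_eq_zero_add, ← (hs (n + 1)).tsum_mul_left, add_assoc,
        ← Summable.tsum_add ((summable_nat_add_iff 1).mpr (hs n)) ((hs (n + 1)).mul_left _)]
      congr 1
      · simp [gaussBinom_zero_right]
      · exact tsum_congr fun j ↦ by rw [gaussBinom_succ_succ']; ring
    rw [qPoch_succ]
    linear_combination ih + qPoch (e * X) (n + 1) * h

theorem tsum_recip_qPoch_eq (e : ℤ⟦X⟧) :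
    ∑' n : ℕ, X ^ (n + 1) * (e ^ n * recip (qPoch (e * X) (n + 1)))
      = ∑' n : ℕ, X ^ (n + 1) * (e ^ n * ∑ p ∈ Finset.HasAntidiagonal.antidiagonal n, gaussBinom p.1 p.2) := by
  -- The double series is summed by rows and by antidiagonals.
  let F : ℕ × ℕ → ℤ⟦X⟧ := fun p ↦ X ^ (p.1 + p.2 + 1) * (e ^ (p.1 + p.2) * gaussBinom p.1 p.2)
  have hF : Summable F := by
    rw [WithPiTopology.summable_iff_summable_coeff]
    intro d
    refine summable_of_hasFiniteSupport
      ((Finset.range (d + 1) ×ˢ Finset.range (d + 1)).finite_toSet.subset fun p hp ↦ ?_)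
    by_contra hc
    refine hp (X_pow_dvd_iff.mp (Dvd.intro _ rfl) d ?_)
    simp only [Finset.coe_product, Finset.coe_range, Set.mem_prod, Set.mem_Iio] at hc
    lia
  have h1 : ∑' p, F p = ∑' n : ℕ, X ^ (n + 1) * (e ^ n * recip (qPoch (e * X) (n + 1))) := by
    rw [hF.tsum_prod' fun n ↦ summable_X_pow_mul (e := fun j ↦ n + j + 1) (fun j ↦ by lia) _]
    refine tsum_congr fun n ↦ ?_
    rw [recip_qPoch_succ_eq_tsum, ← mul_assoc, ← Summable.tsum_mul_left]
    · exact tsum_congr fun j ↦ by simp only [F]; ring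
    · exact summable_X_pow_mul (fun j ↦ le_rfl) _
  rw [← h1, ← Finset.HasAntidiagonal.sigmaAntidiagonalEquivProd.tsum_eq F, Summable.tsum_sigma']
  · refine tsum_congr fun n ↦ ?_
    rw [tsum_fintype]
    refine (Finset.sum_attach (Finset.HasAntidiagonal.antidiagonal n) F).trans ?_
    rw [Finset.mul_sum, Finset.mul_sum]
    refine Finset.sum_congr rfl fun p hp ↦ ?_
    rw [← Finset.HasAntidiagonal.mem_antidiagonal.mp hp]
  · exact fun n ↦ Summable.of_finite
  · exact (Finset.HasAntidiagonal.sigmaAntidiagonalEquivProd.summable_iff (f := F)).mpr hF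

/-- The partitions with parts at most `n`, each part weighted by `e`. -/
theorem genFun_eq_recip_qPoch (e : ℤ) (n : ℕ) :
    Nat.Partition.genFun (fun i c ↦ if i ≤ n then e ^ c else 0) = recip (qPoch ((e : ℤ⟦X⟧) * X) n) := by
  refine eq_recip (constantCoeff_qPoch (constantCoeff_mul_X _) _) ?_
  have hfac : ∀ i : ℕ, (1 + ∑' j : ℕ, (if i + 1 ≤ n then e ^ (j + 1) else 0)
      • (X : ℤ⟦X⟧) ^ ((i + 1) * (j + 1)))
      = if i < n then recip (1 - (e : ℤ⟦X⟧) * X * X ^ i) else 1 := by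
    intro i
    by_cases hi : i < n
    · rw [if_pos hi]
      have hc : constantCoeff ((e : ℤ⟦X⟧) * X * X ^ i) = 0 := by simp
      refine eq_recip (by simp [hc]) ?_
      refine Eq.trans ?_ (WithPiTopology.one_sub_mul_tsum_pow_of_constantCoeff_eq_zero hc)
      rw [(WithPiTopology.summable_pow_of_constantCoeff_eq_zero hc).tsum_eq_zero_add, pow_zero]
      congr 2
      refine tsum_congr fun j ↦ ?_
      rw [if_pos (by lia), zsmul_eq_mul]
      push_cast
      ring
    · rw [if_neg hi]
      simp [show ¬ i + 1 ≤ n by lia]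
  rw [Nat.Partition.genFun_eq_tprod]
  refine (congrArg (_ * ·) (tprod_congr hfac)).trans ?_
  rw [tprod_eq_prod (s := Finset.range n) fun i hi ↦ if_neg (by simpa using hi), qPoch,
    ← Finset.prod_mul_distrib]
  refine Finset.prod_eq_one fun i hi ↦ ?_
  rw [if_pos (by simpa using hi), mul_recip (by simp)]

theorem coeff_recip_qPoch (e : ℤ) (n d : ℕ) :
    coeff d (recip (qPoch ((e : ℤ⟦X⟧) * X) n))
      = ∑ p : d.Partition, if p.parts.sup ≤ n then e ^ p.parts.card else 0 := by
  rw [← genFun_eq_recip_qPoch, Nat.Partition.coeff_genFun]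
  refine Finset.sum_congr rfl fun p _ ↦ ?_
  rw [Finsupp.prod, Multiset.toFinsupp_support]
  simp_rw [Multiset.toFinsupp_apply]
  split_ifs with h
  · rw [Multiset.sup_le] at h
    rw [← Multiset.toFinset_sum_count_eq, ← Finset.prod_pow_eq_pow_sum]
    exact Finset.prod_congr rfl fun i hi ↦ if_pos (h i (by simpa using hi))
  · rw [Multiset.sup_le] at h
    push Not at h
    obtain ⟨i, hi, hni⟩ := h
    exact Finset.prod_eq_zero (by simpa using hi) (if_neg (by lia))

/-- Classify partitions by largest part: those with largest part `n + 1` are counted by a difference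
of consecutive reciprocals. The exponent has the parity of the rank, so `e = -1` gives the rank
signs. -/
theorem tsum_signed_rank (e : ℤ) (he : e ^ 2 = 1) :
    PowerSeries.mk (fun d ↦ ∑ p : d.Partition, e ^ (p.parts.sup + p.parts.card))
      = 1 + ∑' n : ℕ, X ^ (n + 1) * ((e : ℤ⟦X⟧) ^ n * recip (qPoch ((e : ℤ⟦X⟧) * X) (n + 1))) := by
  have he' : (e : ℤ⟦X⟧) ^ 2 = 1 := by exact_mod_cast congrArg (Int.cast : ℤ → ℤ⟦X⟧) he
  have hterm : ∀ n : ℕ, X ^ (n + 1) * ((e : ℤ⟦X⟧) ^ n * recip (qPoch ((e : ℤ⟦X⟧) * X) (n + 1)))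
      = (e : ℤ⟦X⟧) ^ (n + 1) * (recip (qPoch ((e : ℤ⟦X⟧) * X) (n + 1))
        - recip (qPoch ((e : ℤ⟦X⟧) * X) n)) := by
    intro n
    rw [qPoch_succ, recip_mul (constantCoeff_qPoch (constantCoeff_mul_X _) _) (by simp)]
    have h := mul_recip (f := 1 - (e : ℤ⟦X⟧) * X * X ^ n) (by simp)
    linear_combination (-((e : ℤ⟦X⟧) ^ (n + 1) * recip (qPoch ((e : ℤ⟦X⟧) * X) n))) * h
      - X ^ (n + 1) * (e : ℤ⟦X⟧) ^ n * recip (qPoch ((e : ℤ⟦X⟧) * X) n)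
        * recip (1 - (e : ℤ⟦X⟧) * X * X ^ n) * he'
  -- The summand detects `s = i + 1`. Largest part `s = 0` is never detected; it is the empty
  -- partition, supplied by the constant `1`.
  have htel : ∀ s n : ℕ, ∑ i ∈ Finset.range n, e ^ (i + 1) * ((if s ≤ i + 1 then (1 : ℤ) else 0)
      - if s ≤ i then 1 else 0) = if s ≤ n then e ^ s - (if s ≤ 0 then 1 else 0) else 0 := by
    intro s n
    induction n with
    | zero =>
      rcases s with _ | s <;> simp
    | succ n ih =>
      rw [Finset.sum_range_succ, ih]
      rcases lt_trichotomy s (n + 1) with h | rfl | h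
      · simp [show s ≤ n by lia, show s ≤ n + 1 by lia]
      · simp
      · simp [show ¬ s ≤ n by lia, show ¬ s ≤ n + 1 by lia]
  rw [← sub_eq_iff_eq_add']
  refine (hasSum_of_X_pow_dvd (fun n ↦ (pow_dvd_pow _ n.le_succ).mul_right _)
    fun n ↦ X_pow_dvd_iff.mpr fun d hd ↦ ?_).tsum_eq.symm
  have hone : coeff d (1 : ℤ⟦X⟧)
      = ∑ p : d.Partition, if p.parts.sup ≤ 0 then e ^ p.parts.card else 0 := by
    rw [← coeff_recip_qPoch, qPoch_zero, recip_one]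
  have hC : ∀ (k : ℕ) (g : ℤ⟦X⟧), coeff d ((e : ℤ⟦X⟧) ^ k * g) = e ^ k * coeff d g := fun k g ↦ by
    rw [← Int.cast_pow, ← eq_intCast (C (R := ℤ)), coeff_C_mul]
  simp only [hterm, map_sub, map_sum, hC, coeff_recip_qPoch, coeff_mk, hone,
    ← Finset.sum_sub_distrib, Finset.mul_sum]
  rw [Finset.sum_comm, ← Finset.sum_sub_distrib]
  refine Finset.sum_eq_zero fun p _ ↦ ?_
  have hsup : p.parts.sup ≤ n := Multiset.sup_le.mpr fun i hi ↦
    ((Multiset.le_sum_of_mem hi).trans p.parts_sum.le).trans hd.le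
  have := htel p.parts.sup n
  rw [if_pos hsup] at this
  have h2 : ∑ i ∈ Finset.range n, e ^ (i + 1) * ((if p.parts.sup ≤ i + 1 then e ^ p.parts.card else 0)
      - if p.parts.sup ≤ i then e ^ p.parts.card else 0)
      = (e ^ p.parts.sup - if p.parts.sup ≤ 0 then 1 else 0) * e ^ p.parts.card := by
    rw [← this, Finset.sum_mul]
    refine Finset.sum_congr rfl fun i _ ↦ ?_
    rw [mul_assoc, sub_mul, ite_mul, ite_mul, one_mul, zero_mul]
  rw [h2, sub_mul, ite_mul, one_mul, zero_mul, pow_add, sub_self]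

theorem mk_card_partition :
    PowerSeries.mk (fun d ↦ (Fintype.card d.Partition : ℤ)) = recip (qPochInf X) := by
  have h := tsum_signed_rank 1 (one_pow 2)
  have h2 := hasSum_X_pow_mul_recip_qPoch.summable.tsum_eq_zero_add
  rw [hasSum_X_pow_mul_recip_qPoch.tsum_eq] at h2
  rw [h2]
  simpa [qPoch_zero, recip_one] using h

theorem sum_antidiagonal_gaussBinom (m : ℕ) :
    ∑ p ∈ Finset.HasAntidiagonal.antidiagonal (2 * m + 1), gaussBinom p.1 p.2
      = 2 * ∑ j ∈ Finset.range (m + 1), gaussBinom j (2 * m + 1 - j) := by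
  rw [Finset.Nat.sum_antidiagonal_eq_sum_range_succ gaussBinom, Nat.succ_eq_add_one,
    show 2 * m + 1 + 1 = (m + 1) + (m + 1) by ring, Finset.sum_range_add,
    two_mul (Finset.sum _ _)]
  congr 1
  rw [← Finset.sum_range_reflect (fun j ↦ gaussBinom j (2 * m + 1 - j))]
  refine Finset.sum_congr rfl fun j hj ↦ ?_
  have : j < m + 1 := by simpa using hj
  rw [gaussBinom_comm]
  congr 1 <;> lia

/-- The series for `e = 1` and `e = -1` differ by twice the odd-rank count. The symmetry of Gaussian
binomials, which is conjugation, makes that count twice the one for positive odd rank. -/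
theorem mk_evenRankCount :
    PowerSeries.mk (fun n : ℕ ↦ (evenRankCount n : ℤ))
      = recip (qPochInf X) - 2 * rankTailStepTwo 1 := by
  have hcount : 2 * PowerSeries.mk (fun n : ℕ ↦ (evenRankCount n : ℤ))
      = recip (qPochInf X)
        + PowerSeries.mk (fun d ↦ ∑ p : d.Partition, (-1) ^ (p.parts.sup + p.parts.card)) := by
    rw [← mk_card_partition, two_mul]
    ext d
    rw [map_add, map_add, coeff_mk, coeff_mk, coeff_mk, evenRankCount, Fintype.card_subtype,
      ← Finset.card_univ, Finset.card_filter, Finset.card_eq_sum_ones]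
    push_cast
    rw [← Finset.sum_add_distrib, ← Finset.sum_add_distrib]
    refine Finset.sum_congr rfl fun p _ ↦ ?_
    have hiff : Even (partitionRank p) ↔ Even (p.parts.sup + p.parts.card) := by
      rw [partitionRank, Int.even_sub, Nat.even_add, Int.even_coe_nat, Int.even_coe_nat]
    by_cases h : Even (p.parts.sup + p.parts.card)
    · simp [hiff, h, h.neg_one_pow]
    · simp [hiff, h, (Nat.not_even_iff_odd.mp h).neg_one_pow]
  have hplus := tsum_signed_rank 1 (one_pow 2)
  have hminus := tsum_signed_rank (-1) (by norm_num)
  rw [tsum_recip_qPoch_eq] at hplus hminus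
  simp only [one_pow, Finset.sum_const, Finset.card_univ, nsmul_eq_mul, mul_one,
    Int.cast_one, mk_card_partition] at hplus
  have hs : ∀ (f : ℕ → ℤ⟦X⟧), Summable fun n ↦ X ^ (n + 1) * f n :=
    summable_X_pow_mul fun n ↦ n.le_succ
  have heven : ∀ k : ℕ, X ^ (2 * k + 1) * (((1 : ℤ) : ℤ⟦X⟧) ^ (2 * k)
        * ∑ p ∈ Finset.HasAntidiagonal.antidiagonal (2 * k), gaussBinom p.1 p.2)
      - X ^ (2 * k + 1) * (((-1 : ℤ) : ℤ⟦X⟧) ^ (2 * k)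
        * ∑ p ∈ Finset.HasAntidiagonal.antidiagonal (2 * k), gaussBinom p.1 p.2) = 0 := fun k ↦ by
    simp [pow_mul]
  have hodd : ∀ k : ℕ, X ^ (2 * k + 1 + 1) * (((1 : ℤ) : ℤ⟦X⟧) ^ (2 * k + 1)
        * ∑ p ∈ Finset.HasAntidiagonal.antidiagonal (2 * k + 1), gaussBinom p.1 p.2)
      - X ^ (2 * k + 1 + 1) * (((-1 : ℤ) : ℤ⟦X⟧) ^ (2 * k + 1)
        * ∑ p ∈ Finset.HasAntidiagonal.antidiagonal (2 * k + 1), gaussBinom p.1 p.2)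
      = 4 * (X ^ (2 * k + 1 + 1)
        * ∑ j ∈ Finset.range (k + 1), gaussBinom j (2 * k + 1 - j)) := fun k ↦ by
    rw [sum_antidiagonal_gaussBinom, pow_succ ((-1 : ℤ) : ℤ⟦X⟧), pow_mul ((-1 : ℤ) : ℤ⟦X⟧)]
    push_cast
    rw [neg_one_sq, one_pow, one_pow]
    ring
  have hdiff : ∑' n : ℕ, X ^ (n + 1) * (((1 : ℤ) : ℤ⟦X⟧) ^ n
        * ∑ p ∈ Finset.HasAntidiagonal.antidiagonal n, gaussBinom p.1 p.2)
      - ∑' n : ℕ, X ^ (n + 1) * (((-1 : ℤ) : ℤ⟦X⟧) ^ n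
        * ∑ p ∈ Finset.HasAntidiagonal.antidiagonal n, gaussBinom p.1 p.2) = 4 * rankTailStepTwo 1 := by
    -- The index `n` has the parity of the rank, so only odd `n` survive.
    rw [← Summable.tsum_sub (hs _) (hs _), ← tsum_even_add_odd]
    · rw [rankTailStepTwo, ← Summable.tsum_mul_left, tsum_congr heven, tsum_zero, zero_add]
      · exact tsum_congr hodd
      · exact summable_X_pow_mul (fun m ↦ by lia) _
    · simp
    · simp only [← mul_sub]
      exact summable_X_pow_mul (e := fun m ↦ 2 * m + 1 + 1) (fun m ↦ by lia) _
  refine mul_left_cancel₀ (a := (2 : ℤ⟦X⟧))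
    (fun h ↦ by simpa [map_ofNat] using congrArg (constantCoeff (R := ℤ)) h) ?_
  rw [hcount]
  simp only [Int.cast_one, one_pow] at hdiff hplus
  linear_combination hminus - hplus - hdiff

/-! ### A Bailey pair in base `q ^ 2` -/

/-- The pentNat number `r (3 r - 1) / 2`. -/
def pentNat : ℕ → ℕ
  | 0 => 0
  | r + 1 => pentNat r + (3 * r + 1)

/-- The product `(q ^ 2; q ^ 2)_n`. -/
noncomputable def sqPoch (n : ℕ) : ℤ⟦X⟧ := ∏ k ∈ Finset.range n, (1 - X ^ (2 * (k + 1)))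

theorem sqPoch_succ (n : ℕ) : sqPoch (n + 1) = sqPoch n * (1 - X ^ (2 * (n + 1))) :=
  Finset.prod_range_succ _ n

theorem constantCoeff_sqPoch (n : ℕ) : constantCoeff (sqPoch n) = 1 := by
  simp [sqPoch, map_prod]

theorem recip_sqPoch (n : ℕ) :
    recip (sqPoch n) = (1 - X ^ (2 * (n + 1))) * recip (sqPoch (n + 1)) := by
  refine (eq_recip (constantCoeff_sqPoch n) ?_).symm
  rw [← mul_assoc, ← sqPoch_succ, mul_recip (constantCoeff_sqPoch _)]

/-- The kernel `1 / ((Q; Q)_{n - r} (Q; Q)_{n + r})` of Bailey's transform in base `Q = q ^ 2`. -/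
noncomputable def baileyEven (n r : ℕ) : ℤ⟦X⟧ :=
  if r ≤ n then recip (sqPoch (n - r)) * recip (sqPoch (n + r)) else 0

/-- The kernel `1 / ((Q; Q)_{n - r} (Q; Q)_{n + r + 1})` of Bailey's transform in base
`Q = q ^ 2`. -/
noncomputable def baileyOdd (n r : ℕ) : ℤ⟦X⟧ :=
  if r ≤ n then recip (sqPoch (n - r)) * recip (sqPoch (n + r + 1)) else 0

theorem baileyOdd_of_lt {n r : ℕ} (h : n < r) : baileyOdd n r = 0 := if_neg (by lia)

theorem baileyEven_of_lt {n r : ℕ} (h : n < r) : baileyEven n r = 0 := if_neg (by lia)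

theorem baileyEven_eq (n r : ℕ) :
    baileyEven n r = (1 - X ^ (2 * (n + r + 1))) * baileyOdd n r := by
  rw [baileyEven, baileyOdd]
  split_ifs
  · rw [recip_sqPoch (n + r)]; ring
  · simp

theorem baileyEven_succ_eq (r k : ℕ) :
    baileyEven (r + k) (r + 1) = (1 - X ^ (2 * k)) * baileyOdd (r + k) r := by
  rw [baileyEven, baileyOdd, if_pos (show r ≤ r + k by lia)]
  rcases k with _ | k
  · simp
  · rw [if_pos (by lia), show r + (k + 1) - (r + 1) = k by lia,
      show r + (k + 1) - r = k + 1 by lia, recip_sqPoch k, ← add_assoc (r + (k + 1))]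
    ring

theorem baileyOdd_eq (r k : ℕ) :
    baileyOdd (r + k) (r + 1) = (1 - X ^ (2 * k)) * baileyEven (r + k + 1) (r + 1) := by
  rw [baileyEven, baileyOdd, if_pos (show r + 1 ≤ r + k + 1 by lia)]
  rcases k with _ | k
  · simp
  · rw [if_pos (by lia), show r + (k + 1) - (r + 1) = k by lia,
      show r + (k + 1) + 1 - (r + 1) = k + 1 by lia, recip_sqPoch k,
      show r + (k + 1) + 1 + (r + 1) = r + (k + 1) + (r + 1) + 1 by ring]
    ring

theorem baileyOdd_eq_baileyEven_succ (n r : ℕ) :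
    baileyOdd n r = (1 - X ^ (2 * (n + r + 2))) * baileyEven (n + 1) (r + 1) := by
  rw [baileyEven, baileyOdd]
  by_cases h : r ≤ n
  · rw [if_pos h, if_pos (by lia), show n + 1 - (r + 1) = n - r by lia, recip_sqPoch (n + r + 1),
      show n + 1 + (r + 1) = n + r + 1 + 1 by ring]
    ring
  · simp [h]

theorem baileyOdd_mul_one_sub (n s : ℕ) :
    (1 - X ^ (4 * s + 2)) * baileyOdd n s
      = baileyEven n s - X ^ (4 * s + 2) * baileyEven n (s + 1) := by
  rcases le_or_gt s n with h | h
  · obtain ⟨k, rfl⟩ := Nat.exists_eq_add_of_le h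
    rw [baileyEven_eq, baileyEven_succ_eq]
    ring
  · simp [baileyOdd_of_lt h, baileyEven_of_lt h, baileyEven_of_lt (h.trans s.lt_succ_self)]

theorem baileyOdd_mul_one_sub' (n s : ℕ) :
    (1 + X ^ (2 * n + 1)) * ((1 - X ^ (2 * s + 1)) * baileyOdd n s)
      = baileyEven n s - X ^ (2 * s + 1) * baileyEven n (s + 1) := by
  rcases le_or_gt s n with h | h
  · obtain ⟨k, rfl⟩ := Nat.exists_eq_add_of_le h
    rw [baileyEven_eq, baileyEven_succ_eq]
    ring
  · simp [baileyOdd_of_lt h, baileyEven_of_lt h, baileyEven_of_lt (h.trans s.lt_succ_self)]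

/-- The partial sums of Bailey's transform of `α_r = (-1) ^ r (q ^ (r (3 r - 1) / 2)
+ q ^ (r (3 r + 1) / 2))`, `α_0 = 1`. -/
noncomputable def alphaSum (n m : ℕ) : ℤ⟦X⟧ :=
  baileyEven n 0 + ∑ s ∈ Finset.range m,
    (-1) ^ (s + 1) * (X ^ pentNat (s + 1) + X ^ (pentNat (s + 1) + (s + 1)))
      * baileyEven n (s + 1)

theorem alphaSum_succ (n m : ℕ) : alphaSum n (m + 1) = alphaSum n m +
    (-1) ^ (m + 1) * (X ^ pentNat (m + 1) + X ^ (pentNat (m + 1) + (m + 1)))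
      * baileyEven n (m + 1) := by
  rw [alphaSum, Finset.sum_range_succ, ← add_assoc, alphaSum]

/-- Change of kernel from `a = 1` to `a = Q`, by summation by parts. For `m = n` the boundary term
vanishes. -/
theorem sum_baileyOdd_eq (n m : ℕ) :
    ∑ s ∈ Finset.range (m + 1), (-1) ^ s * X ^ pentNat s * ((1 - X ^ (4 * s + 2))
      * baileyOdd n s)
      = alphaSum n m - (-1) ^ m * X ^ (pentNat m + 4 * m + 2) * baileyEven n (m + 1) := by
  induction m with
  | zero => simp [alphaSum, pentNat, baileyOdd_mul_one_sub n 0]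
  | succ m ih =>
    rw [Finset.sum_range_succ, ih, baileyOdd_mul_one_sub, alphaSum_succ, pentNat]
    ring

theorem sum_baileyOdd_eq' (n m : ℕ) :
    (1 + X ^ (2 * n + 1)) * ∑ s ∈ Finset.range (m + 1), (-1) ^ s * X ^ (pentNat s + s)
      * ((1 - X ^ (2 * s + 1)) * baileyOdd n s)
      = alphaSum n m - (-1) ^ m * X ^ pentNat (m + 1) * baileyEven n (m + 1) := by
  induction m with
  | zero =>
    have := baileyOdd_mul_one_sub' n 0
    simp only [zero_add, Finset.sum_range_one, alphaSum, Finset.sum_range_zero, pentNat] at this ⊢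
    linear_combination this
  | succ m ih =>
    rw [Finset.sum_range_succ, mul_add, ih, mul_left_comm, baileyOdd_mul_one_sub', alphaSum_succ]
    simp only [pentNat]
    ring

theorem one_sub_mul_alphaSum (n m : ℕ) :
    (1 - X ^ (4 * (n + 1))) * alphaSum (n + 1) m
      = ∑ s ∈ Finset.range (m + 1), (-1) ^ s * X ^ (pentNat s + s)
        * ((1 - X ^ (2 * s + 1)) * baileyOdd n s)
        + (-1) ^ m * (X ^ pentNat (m + 1) + X ^ (2 * n + 2 + pentNat m + 2 * m))
          * baileyOdd n m := by
  induction m with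
  | zero =>
    have h : baileyOdd n 0 = (1 - X ^ (2 * (n + 1))) * baileyEven (n + 1) 0 := by
      rw [baileyOdd, baileyEven, if_pos (Nat.zero_le _), if_pos (Nat.zero_le _), Nat.sub_zero, Nat.sub_zero,
        recip_sqPoch n]
      ring
    simp only [zero_add, Finset.sum_range_one, alphaSum, Finset.sum_range_zero, pentNat, h]
    ring
  | succ m ih =>
    rw [Finset.sum_range_succ, alphaSum_succ, mul_add, ih]
    rcases le_or_gt m n with h | h
    · obtain ⟨k, rfl⟩ := Nat.exists_eq_add_of_le h
      rw [baileyOdd_eq, baileyOdd_eq_baileyEven_succ (m + k) m]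
      simp only [pentNat]
      ring
    · simp [baileyOdd_of_lt h, baileyEven_of_lt (show n + 1 < m + 1 by lia),
        baileyOdd_of_lt (h.trans m.lt_succ_self)]

/-- The sums at `n` and at `n + 1` both reduce to one sum over `baileyOdd n`; the boundary terms
carry kernels with second index beyond the first, hence vanish. -/
theorem alphaSum_self_succ (n : ℕ) :
    (1 + X ^ (2 * n + 1)) * (1 - X ^ (4 * (n + 1))) * alphaSum (n + 1) (n + 1)
      = alphaSum n n := by
  have h1 := one_sub_mul_alphaSum n (n + 1)
  have h2 := sum_baileyOdd_eq' n n
  rw [Finset.sum_range_succ, baileyOdd_of_lt n.lt_succ_self] at h1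
  rw [baileyEven_of_lt n.lt_succ_self] at h2
  linear_combination (1 + X ^ (2 * n + 1)) * h1 + h2

theorem qPoch_neg_mul_alphaSum (n : ℕ) :
    qPoch (-X) (2 * n) * sqPoch n * alphaSum n n = 1 := by
  induction n with
  | zero => simp [qPoch_zero, sqPoch, alphaSum, baileyEven, recip_one]
  | succ n ih =>
    refine Eq.trans ?_ ih
    rw [show 2 * (n + 1) = 2 * n + 1 + 1 by ring, qPoch_succ, qPoch_succ, sqPoch_succ,
      ← alphaSum_self_succ n]
    ring

theorem qPoch_X_mul_qPoch_neg (n : ℕ) : qPoch X n * qPoch (-X) n = sqPoch n := by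
  rw [qPoch, qPoch, sqPoch, ← Finset.prod_mul_distrib]
  exact Finset.prod_congr rfl fun k _ ↦ by ring

theorem constantCoeff_qPoch_neg (n m : ℕ) : constantCoeff (qPoch (-X ^ (n + 1)) m) = 1 :=
  constantCoeff_qPoch (by simp) m

theorem fineSumTerm_succ (n : ℕ) : fineSumTerm (n + 1)
    = X ^ (2 * (n + 1)) * sqPoch n * sqPoch (n + 1) * alphaSum (n + 1) (n + 1) := by
  have hc : constantCoeff ((1 - X ^ (2 * (n + 1)) : ℤ⟦X⟧)
      * qPoch (-X ^ (n + 1 + 1)) (n + 1)) = 1 := by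
    simp [constantCoeff_qPoch_neg (n + 1)]
  rw [fineSumTerm, ← eq_recip hc (g := qPoch (-X) (n + 1) * sqPoch n * alphaSum (n + 1) (n + 1)),
    ← qPoch_X_mul_qPoch_neg (n + 1)]
  · ring
  · refine Eq.trans ?_ (qPoch_neg_mul_alphaSum (n + 1))
    rw [two_mul (n + 1), qPoch_add (-X) (n + 1), sqPoch_succ,
      show -X * X ^ (n + 1) = (-X ^ (n + 1 + 1) : ℤ⟦X⟧) by ring]
    ring

/-! ### Evaluation of the sum with the Bailey pair inserted -/

theorem one_sub_X_pow_mul_recip (n : ℕ) :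
    (1 - X ^ (2 * (n + 1)) : ℤ⟦X⟧) * recip (1 - X ^ (2 * (n + 1))) = 1 :=
  mul_recip (by simp)

theorem sqPoch_mul_recip (n : ℕ) : sqPoch n * recip (sqPoch n) = 1 :=
  mul_recip (constantCoeff_sqPoch n)

theorem X_pow_dvd_mul_sub_one {a b : ℤ⟦X⟧} {n : ℕ} (ha : (X : ℤ⟦X⟧) ^ n ∣ a - 1)
    (hb : (X : ℤ⟦X⟧) ^ n ∣ b - 1) : (X : ℤ⟦X⟧) ^ n ∣ a * b - 1 := by
  rw [show a * b - 1 = (a - 1) * b + (b - 1) by ring]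
  exact dvd_add (ha.mul_right _) hb

theorem X_pow_dvd_sqPoch_add_sub (n m : ℕ) :
    (X : ℤ⟦X⟧) ^ (2 * (n + 1)) ∣ sqPoch (n + m) - sqPoch n := by
  induction m with
  | zero => simp
  | succ m ih =>
    rw [← add_assoc, sqPoch_succ, show sqPoch (n + m) * (1 - X ^ (2 * (n + m + 1))) - sqPoch n
      = (sqPoch (n + m) - sqPoch n) - X ^ (2 * (n + m + 1)) * sqPoch (n + m) by ring]
    exact dvd_sub ih ((pow_dvd_pow _ (by lia)).mul_right _)

theorem X_pow_dvd_sqPoch_mul_recip_sub_one (n i j : ℕ) :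
    (X : ℤ⟦X⟧) ^ (2 * (n + 1)) ∣ sqPoch (n + i) * recip (sqPoch (n + j)) - 1 := by
  rw [show sqPoch (n + i) * recip (sqPoch (n + j)) - 1
    = ((sqPoch (n + i) - sqPoch n) - (sqPoch (n + j) - sqPoch n)) * recip (sqPoch (n + j)) by
      linear_combination sqPoch_mul_recip (n + j)]
  exact (dvd_sub (X_pow_dvd_sqPoch_add_sub n i) (X_pow_dvd_sqPoch_add_sub n j)).mul_right _

/-- The quantitative form of the limit of the closed form in `conjSum_succ_right`, with `N = r + k`.
-/
theorem X_pow_dvd_sqPoch_mul_baileyOdd_sub_one (r k : ℕ) : (X : ℤ⟦X⟧) ^ (2 * (k + 1)) ∣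
    sqPoch (r + k) * sqPoch (r + k + 1) * baileyOdd (r + k) r - 1 := by
  have h1 := X_pow_dvd_sqPoch_mul_recip_sub_one k r 0
  have h2 := X_pow_dvd_sqPoch_mul_recip_sub_one k (r + 1) (2 * r + 1)
  have := X_pow_dvd_mul_sub_one h1 h2
  rw [baileyOdd, if_pos (by lia), show r + k - r = k by lia]
  rw [show k + r = r + k by ring, show k + (r + 1) = r + k + 1 by ring,
    show k + (2 * r + 1) = r + k + r + 1 by ring, add_zero] at this
  convert this using 2
  ring

/-- The partial sums, over `n`, of the conjugate Bailey pair. -/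
noncomputable def conjSum (N r : ℕ) : ℤ⟦X⟧ :=
  ∑ n ∈ Finset.range N, X ^ (2 * (n + 1)) * sqPoch n * sqPoch (n + 1) * baileyOdd (n + 1) r

theorem conjSum_succ_right (N r : ℕ) :
    (1 - X ^ (2 * (r + 1))) * (1 - X ^ (2 * (r + 2))) * conjSum N (r + 1)
      = X ^ (2 * (r + 1)) * (sqPoch N * sqPoch (N + 1) * baileyOdd N (r + 1)) := by
  induction N with
  | zero => simp [conjSum, baileyOdd_of_lt]
  | succ N ih =>
    rw [conjSum, Finset.sum_range_succ, ← conjSum, mul_add, ih]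
    rcases le_or_gt r N with h | h
    · obtain ⟨k, rfl⟩ := Nat.exists_eq_add_of_le h
      rw [baileyOdd_eq, baileyEven_eq, sqPoch_succ (r + k + 1), sqPoch_succ (r + k)]
      ring
    · simp [baileyOdd_of_lt (show N < r + 1 by lia), baileyOdd_of_lt (show N + 1 < r + 1 by lia)]

/-- The index `r = 0` needs its own telescoping, since the factor `1 - Q^r` of the general closed
form is then zero. -/
theorem one_sub_mul_conjSum_zero (N : ℕ) :
    (1 - X ^ 2) * conjSum N 0 = recip (1 - X ^ (2 * (0 + 1))) - recip (1 - X ^ (2 * (N + 1))) := by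
  induction N with
  | zero => simp [conjSum]
  | succ N ih =>
    rw [conjSum, Finset.sum_range_succ, ← conjSum, mul_add, ih, baileyOdd, if_pos (Nat.zero_le _),
      Nat.sub_zero, add_zero]
    have h0 : sqPoch N * recip (sqPoch (N + 1 + 1))
        = recip (1 - X ^ (2 * (N + 1))) * recip (1 - X ^ (2 * (N + 1 + 1))) := by
      rw [sqPoch_succ (N + 1), sqPoch_succ N, recip_mul, recip_mul (constantCoeff_sqPoch N)]
      · linear_combination (recip (1 - X ^ (2 * (N + 1))) * recip (1 - X ^ (2 * (N + 1 + 1))))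
          * sqPoch_mul_recip N
      all_goals simp [constantCoeff_sqPoch]
    have h1 := one_sub_X_pow_mul_recip N
    have h2 := one_sub_X_pow_mul_recip (N + 1)
    linear_combination ((1 - X ^ 2) * X ^ (2 * (N + 1)) * sqPoch N * recip (sqPoch (N + 1 + 1)))
        * sqPoch_mul_recip (N + 1) + (1 - X ^ 2) * X ^ (2 * (N + 1)) * h0
        + recip (1 - X ^ (2 * (N + 1))) * h2 - recip (1 - X ^ (2 * (N + 1 + 1))) * h1

theorem sum_fineSumTerm (N : ℕ) :
    ∑ n ∈ Finset.range N, fineSumTerm (n + 1)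
      = ∑ s ∈ Finset.range (N + 1), (-1) ^ s * X ^ pentNat s * (1 - X ^ (4 * s + 2))
        * conjSum N s := by
  have h : ∀ n ∈ Finset.range N, fineSumTerm (n + 1) = ∑ s ∈ Finset.range (N + 1),
      (-1) ^ s * X ^ pentNat s * (1 - X ^ (4 * s + 2))
        * (X ^ (2 * (n + 1)) * sqPoch n * sqPoch (n + 1) * baileyOdd (n + 1) s) := by
    intro n hn
    have hn' : n < N := by simpa using hn
    have h1 := sum_baileyOdd_eq (n + 1) (n + 1)
    rw [baileyEven_of_lt (Nat.lt_succ_self _), mul_zero, sub_zero] at h1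
    rw [fineSumTerm_succ, ← h1, Finset.mul_sum]
    refine (Finset.sum_congr rfl fun s _ ↦ ?_).trans
      (Finset.sum_subset (Finset.range_mono (by lia : n + 1 + 1 ≤ N + 1)) fun s _ hs ↦ ?_)
    · ring
    · rw [baileyOdd_of_lt (by simpa using hs)]
      ring
  rw [Finset.sum_congr rfl h, Finset.sum_comm]
  simp only [conjSum, Finset.mul_sum]

/-! ### Emergence of Fine's series and passage to the limit -/

theorem two_mul_pentNat (r : ℕ) : 2 * pentNat r + r = 3 * r ^ 2 := by
  induction r with
  | zero => rfl
  | succ r ih => rw [pentNat]; linarith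

theorem le_pentNat (r : ℕ) : r ≤ pentNat r := by
  induction r with
  | zero => rfl
  | succ r ih => rw [pentNat]; lia

theorem fineTerm_succ (n : ℕ) : fineTerm (n + 1) = (-1) ^ (n + 1) * X ^ (pentNat (n + 1) + (n + 1))
    * ((1 - X ^ (n + 1)) * recip (1 - X ^ (2 * (n + 1)))) := by
  have he : (n + 1) * (3 * (n + 1) + 1) / 2 = pentNat (n + 1) + (n + 1) := by
    have := two_mul_pentNat (n + 1)
    rw [show (n + 1) * (3 * (n + 1) + 1) = 3 * (n + 1) ^ 2 + (n + 1) by ring, ← this]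
    lia
  rw [fineTerm, he, ← eq_recip (by simp) (g := (1 - X ^ (n + 1)) * recip (1 - X ^ (2 * (n + 1))))]
  linear_combination one_sub_X_pow_mul_recip n

/-- Partial fractions: `q^(2s)(1 - q^(4s+2)) / ((1 - q^(2s))(1 - q^(2s+2)))` equals `q^(2s)/(1 -
q^(2s)) + q^(4s+2)/(1 - q^(2s+2))`. Collecting the two contributions with the same denominator
leaves a factor `1 - q^s`, which reduces that denominator to `1 + q^s`. -/
theorem sum_fineTerm (N : ℕ) :
    X ^ 2 * recip (1 - X ^ (2 * (0 + 1))) + ∑ s ∈ Finset.range N, (-1) ^ (s + 1)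
      * X ^ pentNat (s + 1) * (1 - X ^ (4 * (s + 1) + 2)) * (X ^ (2 * (s + 1))
        * (recip (1 - X ^ (2 * (s + 1))) * recip (1 - X ^ (2 * (s + 1 + 1)))))
      = -∑ n ∈ Finset.range N, fineTerm (n + 1)
        + (-1) ^ N * X ^ (pentNat N + 4 * N + 2) * recip (1 - X ^ (2 * (N + 1))) := by
  induction N with
  | zero => simp [pentNat]
  | succ N ih =>
    rw [Finset.sum_range_succ, Finset.sum_range_succ, ← add_assoc, ih, fineTerm_succ]
    have h1 := one_sub_X_pow_mul_recip N
    have h2 := one_sub_X_pow_mul_recip (N + 1)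
    simp only [pentNat]
    linear_combination (-1) ^ (N + 1) * X ^ (pentNat N + (3 * N + 1) + 2 * (N + 1))
      * (recip (1 - X ^ (2 * (N + 1))) * h2
        + X ^ (2 * (N + 2)) * recip (1 - X ^ (2 * (N + 1 + 1))) * h1)

theorem X_pow_dvd_tsum_sub_sum {f : ℕ → ℤ⟦X⟧} (hs : Summable f) (hf : ∀ n, (X : ℤ⟦X⟧) ^ n ∣ f n)
    (n : ℕ) : (X : ℤ⟦X⟧) ^ n ∣ ∑' i, f i - ∑ i ∈ Finset.range n, f i := by
  rw [← hs.sum_add_tsum_nat_add n, add_sub_cancel_left]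
  exact X_pow_dvd_tsum ((summable_nat_add_iff n).mpr hs) fun i ↦
    (pow_dvd_pow _ (by lia)).trans (hf (i + n))

theorem X_pow_dvd_sum_fineSumTerm_add_sum_fineTerm (N : ℕ) : (X : ℤ⟦X⟧) ^ N ∣
    ∑ n ∈ Finset.range N, fineSumTerm (n + 1) + ∑ n ∈ Finset.range N, fineTerm (n + 1) := by
  have key : ∑ n ∈ Finset.range N, fineSumTerm (n + 1) + ∑ n ∈ Finset.range N, fineTerm (n + 1)
      = ∑ s ∈ Finset.range N, (-1) ^ (s + 1)
      * X ^ pentNat (s + 1) * (1 - X ^ (4 * (s + 1) + 2)) * (X ^ (2 * (s + 1))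
        * (recip (1 - X ^ (2 * (s + 1))) * recip (1 - X ^ (2 * (s + 1 + 1)))))
        * (sqPoch N * sqPoch (N + 1) * baileyOdd N (s + 1) - 1)
      + X ^ N * (X ^ (N + 2) * -recip (1 - X ^ (2 * (N + 1)))
        + (-1) ^ N * X ^ (pentNat N + 3 * N + 2) * recip (1 - X ^ (2 * (N + 1)))) := by
    have hc : ∀ s, conjSum N (s + 1) = X ^ (2 * (s + 1))
        * (recip (1 - X ^ (2 * (s + 1))) * recip (1 - X ^ (2 * (s + 1 + 1))))
        * (sqPoch N * sqPoch (N + 1) * baileyOdd N (s + 1)) := by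
      intro s
      have h1 := one_sub_X_pow_mul_recip s
      have h2 := one_sub_X_pow_mul_recip (s + 1)
      linear_combination (recip (1 - X ^ (2 * (s + 1))) * recip (1 - X ^ (2 * (s + 1 + 1))))
        * conjSum_succ_right N s - (1 - X ^ (2 * (s + 2))) * recip (1 - X ^ (2 * (s + 1 + 1)))
          * conjSum N (s + 1) * h1 - conjSum N (s + 1) * h2
    have h0 := one_sub_mul_conjSum_zero N
    have h1 := sum_fineTerm N
    have h2 := one_sub_X_pow_mul_recip N
    have h3 := one_sub_X_pow_mul_recip 0
    rw [sum_fineSumTerm, Finset.sum_range_succ']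
    simp only [hc, mul_sub_one, Finset.sum_sub_distrib, pentNat, ← mul_assoc] at h1 ⊢
    linear_combination h0 + h1 - h2 + h3
  rw [key]
  refine dvd_add (Finset.dvd_sum fun s hs ↦ ?_) (dvd_mul_right _ _)
  obtain ⟨k, rfl⟩ := Nat.exists_eq_add_of_lt (show s < N by simpa using hs)
  have h := X_pow_dvd_sqPoch_mul_baileyOdd_sub_one (s + 1) k
  rw [show s + 1 + k = s + k + 1 by ring] at h
  have h2 : (X : ℤ⟦X⟧) ^ (s + 1) ∣ X ^ pentNat (s + 1) := pow_dvd_pow _ (le_pentNat _)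
  -- Here `N = s + k + 1`: the pentagonal power supplies `s + 1` factors `X`, the kernel congruence
  -- the other `2 * (k + 1)`.
  refine (pow_dvd_pow X (by lia : s + k + 1 ≤ s + 1 + 2 * (k + 1))).trans ?_
  rw [pow_add]
  exact mul_dvd_mul (((h2.mul_left _).mul_right _).mul_right _) h

theorem X_pow_dvd_fineTerm (n : ℕ) : (X : ℤ⟦X⟧) ^ n ∣ fineTerm (n + 1) := by
  rw [fineTerm_succ]
  exact ((pow_dvd_pow _ (by lia)).mul_left _).mul_right _

theorem X_pow_dvd_fineSumTerm (n : ℕ) : (X : ℤ⟦X⟧) ^ n ∣ fineSumTerm (n + 1) := by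
  rw [fineSumTerm]
  exact ((pow_dvd_pow _ (by lia)).mul_left _).mul_right _

theorem hasSum_fineSumTerm :
    HasSum (fun n : ℕ ↦ fineSumTerm (n + 1)) (-∑' n : ℕ, fineTerm (n + 1)) := by
  refine hasSum_of_X_pow_dvd X_pow_dvd_fineSumTerm fun n ↦ ?_
  have h1 := X_pow_dvd_tsum_sub_sum summable_fineTerm X_pow_dvd_fineTerm n
  have h2 := X_pow_dvd_sum_fineSumTerm_add_sum_fineTerm n
  convert (dvd_add h1 h2).neg_right using 1
  ring

theorem evenRankTerm_succ (n : ℕ) :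
    evenRankTerm (n + 1) = recip (qPochInf X) * fineSumTerm (n + 1) := by
  have hX : constantCoeff ((X : ℤ⟦X⟧) ^ (n + 1 + 1)) = 0 := by simp
  have h1 : constantCoeff (1 - (X : ℤ⟦X⟧) ^ (2 * (n + 1))) = 1 := by simp
  rw [evenRankTerm, fineSumTerm, qPochInf_eq_qPoch_mul X (n + 1), ← pow_succ',
    recip_mul (by simp [constantCoeff_qPoch_neg (n + 1)]) (constantCoeff_qPochInf hX),
    recip_mul (constantCoeff_qPoch_X _) (constantCoeff_qPochInf hX)]
  linear_combination (-X ^ (2 * (n + 1)) * recip ((1 - X ^ (2 * (n + 1)))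
    * qPoch (-X ^ (n + 1 + 1)) (n + 1)) * recip (qPochInf (X ^ (n + 1 + 1))))
    * mul_recip (constantCoeff_qPoch_X (n + 1))

theorem corollary1p4 :
    (Summable (fun n : ℕ ↦ evenRankTerm (n + 1)) ∧
      PowerSeries.mk (fun n : ℕ ↦ (evenRankCount n : ℤ)) =
        recip (qPochInf PowerSeries.X) - 2 * ∑' n : ℕ, evenRankTerm (n + 1)) ∧
    (Summable (fun n : ℕ ↦ fineSumTerm (n + 1)) ∧
      PowerSeries.mk fineJ = -∑' n : ℕ, fineSumTerm (n + 1)) := by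
  refine ⟨⟨?_, ?_⟩, hasSum_fineSumTerm.summable, ?_⟩
  · exact (hasSum_fineSumTerm.summable.mul_left _).congr fun n ↦ (evenRankTerm_succ n).symm
  · rw [mk_evenRankCount, rankTailStepTwo_eq, rankLerch_one, tsum_congr evenRankTerm_succ,
      hasSum_fineSumTerm.summable.tsum_mul_left, hasSum_fineSumTerm.tsum_eq]
  · rw [hasSum_fineSumTerm.tsum_eq, neg_neg]
    ext n
    rw [coeff_mk, fineJ]
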